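/- **Proposition 3.2.** Let $\psi:\{1,2,\dots\}\to\mathbb R$ satisfy $\psi(k)>-1$ for all $k\ge 1$ and $\psi(k)\to 0$ as $k\to\infty$. Put $w(k)=(1+\psi(k))k^{-5/2}$, $\overline w=\sum_{\ell\ge 1}w(\ell)$ and $p(k)=w(k)/\overline w$ for $k\ge 1$. Let $\xi_1,\xi_2,\dots$ be independent random variables with $\mathbb P(\xi_i=k)=p(k)$ for all $i,k\ge 1$; write $S_k=\xi_1+\dots+\xi_k$ and $\nu=\mathbb E[\xi_1]$. Let $r(n)$ be positive integers with $r(n)=o(n)$ and $r(n)>(\ln n)^{25}$ for all sufficiently large $n$, put $m(n)=n-r(n)$, and let $N(n)$ be integers with $1\le N(n)\le m(n)$ for all sufficiently large $n$. Let $\xi_{(1)}\ge\xi_{(2)}\ge\dots\ge\xi_{(N(n))}$ be the decreasing rearrangement of $\xi_1,\dots,\xi_{N(n)}$ (with $\xi_{(2)}=0$ if $N(n)=1$). If $\limsup_{n\to\infty}\frac{\nu N(n)}{m(n)}<1$, then $\mathbb P(S_{N(n)}=m(n))>0$ for all sufficiently large $n$, and, as $n\to\infty$, $$\mathbb P\left(\xi_{(1)}>\frac{m(n)}{(\ln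 n)^2},\ \xi_{(2)}>r(n)^{5/6}\ \Big|\ S_{N(n)}=m(n)\right)=O\left(N(n)(\ln n)^5\,r(n)^{-5/4}\right).$$ -/

import Mathlib

open MeasureTheory ProbabilityTheory Filter Topology Asymptotics

noncomputable section

namespace RandomAllocation

/-- The weight `w(k) = (1 + ψ(k)) / k^{5/2}` of an integer `k ≥ 1`. -/
def weight (ψ : ℕ → ℝ) (k : ℕ) : ℝ := (1 + ψ k) / (k : ℝ) ^ ((5 : ℝ) / 2)

/-- The total weight `∑_{ℓ ≥ 1} w(ℓ)`. -/
def totalWeight (ψ : ℕ → ℝ) : ℝ := ∑' l : ℕ, weight ψ (l + 1)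

/-- The probability `p(k) = w(k) / ∑_{ℓ ≥ 1} w(ℓ)` of an integer `k ≥ 1`. -/
def prob (ψ : ℕ → ℝ) (k : ℕ) : ℝ := weight ψ k / totalWeight ψ

/-- `kthLargest x N j` is the entry `x_{(j)}` of the decreasing rearrangement
`x_{(1)} ≥ x_{(2)} ≥ … ≥ x_{(N)}` of the `N` numbers `x 0, …, x (N - 1)`, for `1 ≤ j ≤ N`
(multiplicities are counted). It is `0` when `j > N`. -/
def kthLargest (x : ℕ → ℕ) (N j : ℕ) : ℕ :=
  (((Multiset.range N).map x).sort (· ≥ ·)).getD (j - 1) 0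

end RandomAllocation

end

namespace RandomAllocation

/-! The conditional probability is bounded as a quotient, by the principle of one big jump. Write `m
= n - r n`. Denominator (`exists_le_measure_sum_eq`): since `ν N / m` stays below 1, with
probability bounded below all variables but one are moderate and sum to less than a fixed fraction
of `m`. The remaining one then fills the gap, at cost at least of order `m ^ (-5/2)`. The `N`
choices of it give disjoint events, hence a bound of order `N * m ^ (-5/2)`. Numerator
(`exists_measure_two_large_le`): for each ordered pair of indices, the sum constraint fixes the
value, larger than `a`, of one variable given the others, and the other variable exceeds `b`. The
cost is of order `a ^ (-5/2) * b ^ (-3/2)`, over at most `N ^ 2` pairs. With `a = m / log n ^ 2` and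
`b = r ^ (5/6)` the powers of `m` cancel and one factor `N` remains. -/

/-! ### Order statistics. -/

/-- Peeling the two largest values off the multiset one after the other yields distinct indices,
even for equal values. `hb` excludes the default value `0` of a missing second entry. -/
theorem exists_ne_of_lt_kthLargest {x : ℕ → ℕ} {N : ℕ} {a b : ℝ} (hb : 0 ≤ b)
    (h1 : a < (kthLargest x N 1 : ℝ)) (h2 : b < (kthLargest x N 2 : ℝ)) :
    ∃ i ∈ Finset.range N, ∃ j ∈ (Finset.range N).erase i, a < x i ∧ b < x j := by
  unfold kthLargest at h1 h2
  have hl := Multiset.sort_eq ((Multiset.range N).map x) (· ≥ ·)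
  revert h1 h2 hl
  generalize ((Multiset.range N).map x).sort (· ≥ ·) = l
  intro h1 h2 hl
  match l with
  | [] => simp at h2; linarith
  | [u] => simp at h2; linarith
  | u :: v :: t =>
    simp only [List.getD_eq_getElem?_getD] at h1 h2
    simp at h1 h2
    obtain ⟨i, hi, hxi, he⟩ := Multiset.map_eq_cons x _ _ _ |>.2 (hl.symm.trans (Multiset.cons_coe _ _).symm)
    obtain ⟨j, hj, hxj, -⟩ := Multiset.map_eq_cons x _ _ _ |>.2 (he.trans (Multiset.cons_coe _ _).symm)
    refine ⟨i, by simpa using hi, j, ?_, by rwa [hxi], by rwa [hxj]⟩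
    rw [Multiset.Nodup.mem_erase_iff (Multiset.nodup_range N)] at hj
    simpa using hj

/-! ### Conditioning on an independent variable. -/

/-- A joint constraint on two independent discrete variables has as probability the mean, over the
first variable, of the probability that the second one meets the constraint. -/
theorem measure_joint_eq_lintegral {Ω β : Type*} [MeasurableSpace Ω] {P : Measure Ω}
    [IsProbabilityMeasure P] [MeasurableSpace β] [Countable β] [DiscreteMeasurableSpace β]
    {T : Ω → β} {X : Ω → ℕ} (hT : Measurable T) (hX : Measurable X) (h : IndepFun T X P)
    (g : β → Set ℕ) :
    P {ω | X ω ∈ g (T ω)} = ∫⁻ ω, P {ω' | X ω' ∈ g (T ω)} ∂P := by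
  have hm := (indepFun_iff_map_prod_eq_prod_map_map hT.aemeasurable hX.aemeasurable).1 h
  have hS : MeasurableSet {z : β × ℕ | z.2 ∈ g z.1} := .of_discrete
  have e1 : P {ω | X ω ∈ g (T ω)} = (P.map fun ω => (T ω, X ω)) {z : β × ℕ | z.2 ∈ g z.1} := by
    rw [Measure.map_apply (hT.prodMk hX) hS]; rfl
  have := Measure.isProbabilityMeasure_map (μ := P) hX.aemeasurable
  rw [e1, hm, Measure.prod_apply hS, lintegral_map (measurable_of_countable _) hT]
  refine lintegral_congr fun ω => ?_
  rw [Measure.map_apply hX .of_discrete]; rfl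

theorem measure_joint_le {Ω β : Type*} [MeasurableSpace Ω] {P : Measure Ω}
    [IsProbabilityMeasure P] [MeasurableSpace β] [Countable β] [DiscreteMeasurableSpace β]
    {T : Ω → β} {X : Ω → ℕ} (hT : Measurable T) (hX : Measurable X) (h : IndepFun T X P)
    (B : Set β) (g : β → Set ℕ) {M : ENNReal} (hM : ∀ t ∈ B, P {ω | X ω ∈ g t} ≤ M) :
    P {ω | T ω ∈ B ∧ X ω ∈ g (T ω)} ≤ M * P {ω | T ω ∈ B} := by
  classical
  have hB : MeasurableSet {ω | T ω ∈ B} := hT .of_discrete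
  have := measure_joint_eq_lintegral hT hX h (fun t => {k | t ∈ B ∧ k ∈ g t})
  simp only [Set.mem_ofPred_eq] at this
  rw [this, ← lintegral_indicator_const hB]
  refine lintegral_mono fun ω => ?_
  by_cases hω : T ω ∈ B
  · simpa [Set.indicator, hω] using hM _ hω
  · simp [hω]

theorem le_measure_joint {Ω β : Type*} [MeasurableSpace Ω] {P : Measure Ω}
    [IsProbabilityMeasure P] [MeasurableSpace β] [Countable β] [DiscreteMeasurableSpace β]
    {T : Ω → β} {X : Ω → ℕ} (hT : Measurable T) (hX : Measurable X) (h : IndepFun T X P)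
    (B : Set β) (g : β → Set ℕ) {M : ENNReal} (hM : ∀ t ∈ B, M ≤ P {ω | X ω ∈ g t}) :
    M * P {ω | T ω ∈ B} ≤ P {ω | T ω ∈ B ∧ X ω ∈ g (T ω)} := by
  classical
  have hB : MeasurableSet {ω | T ω ∈ B} := hT .of_discrete
  have := measure_joint_eq_lintegral hT hX h (fun t => {k | t ∈ B ∧ k ∈ g t})
  simp only [Set.mem_ofPred_eq] at this
  rw [this, ← lintegral_indicator_const hB]
  refine lintegral_mono fun ω => ?_
  by_cases hω : T ω ∈ B
  · simpa [Set.indicator, hω] using hM _ hω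
  · simp [hω]

theorem indepFun_restrict {Ω : Type*} [MeasurableSpace Ω] {P : Measure Ω}
    {ξ : ℕ → Ω → ℕ} (hξ_meas : ∀ i, Measurable (ξ i)) (hξ_indep : iIndepFun ξ P)
    {s : Finset ℕ} {i : ℕ} (hi : i ∉ s) :
    IndepFun (fun ω (l : s) => ξ l ω) (ξ i) P := by
  have h := hξ_indep.indepFun_finset s {i} (by simpa using hi) hξ_meas
  exact h.comp (φ := id) (ψ := fun f : (({i} : Finset ℕ) → ℕ) => f ⟨i, by simp⟩)
    measurable_id (measurable_pi_apply _)

/-! ### Estimates on the point probabilities. -/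

/-- Makes tail sums telescope. With `a = √k` and `b = √(k+1)`, the identity `(b - a) * (a + b) = 1`
gives `b ^ 3 - a ^ 3 ≥ b`, and `b ^ 2 ≤ 2 * a ^ 2` accounts for the factor 2. -/
theorem rpow_neg_five_halves_le {k : ℕ} (hk : 1 ≤ k) :
    (k : ℝ) ^ (-(5 : ℝ) / 2) ≤
      2 * ((k : ℝ) ^ (-(3 : ℝ) / 2) - ((k + 1 : ℕ) : ℝ) ^ (-(3 : ℝ) / 2)) := by
  have key : ∀ x : ℝ, 0 < x → ∀ d : ℕ, x ^ (-(d : ℝ) / 2) = ((Real.sqrt x) ^ d)⁻¹ := by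
    intro x hx d
    rw [Real.sqrt_eq_rpow, ← Real.rpow_natCast, ← Real.rpow_mul hx.le, ← Real.rpow_neg hx.le]
    congr 1; ring
  have hk0 : (1 : ℝ) ≤ k := by exact_mod_cast hk
  have h5 := key k (by linarith) 5
  have h3 := key k (by linarith) 3
  have h3' := key (k + 1 : ℕ) (by positivity) 3
  push_cast at h5 h3 h3' ⊢
  rw [h5, h3, h3']
  have ha : 0 < √(k : ℝ) := Real.sqrt_pos.2 (by linarith)
  have hb : 0 < √((k : ℝ) + 1) := Real.sqrt_pos.2 (by linarith)
  have ha2 : √(k : ℝ) ^ 2 = k := Real.sq_sqrt (by linarith)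
  have hb2 : √((k : ℝ) + 1) ^ 2 = k + 1 := Real.sq_sqrt (by linarith)
  generalize √(k : ℝ) = a at *
  generalize √((k : ℝ) + 1) = b at *
  have hab : b ^ 2 = a ^ 2 + 1 := by linarith
  have hb2a : b ^ 2 ≤ 2 * a ^ 2 := by linarith
  have hd : 1 ≤ (b ^ 3 - a ^ 3) / b := by
    rw [le_div_iff₀ hb]
    have : (b - a) * (a + b) = 1 := by linarith
    have h0 : 0 < b - a := by
      by_contra hc
      nlinarith [add_pos ha hb]
    nlinarith [mul_nonneg h0.le (sq_nonneg a)]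
  have : (a ^ 3)⁻¹ - (b ^ 3)⁻¹ = (b ^ 3 - a ^ 3) / b * ((a ^ 3)⁻¹ * (b ^ 2)⁻¹) := by
    field_simp
  rw [this]
  have h1 : (2 * a ^ 2)⁻¹ ≤ (b ^ 2)⁻¹ := by gcongr
  calc (a ^ 5)⁻¹ = 2 * (1 * ((a ^ 3)⁻¹ * (2 * a ^ 2)⁻¹)) := by field_simp
    _ ≤ _ := by gcongr

variable {ψ : ℕ → ℝ}

theorem weight_eq (ψ : ℕ → ℝ) (k : ℕ) : weight ψ k = (1 + ψ k) * (k : ℝ) ^ (-(5 : ℝ) / 2) := by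
  rw [weight, div_eq_mul_inv, ← Real.rpow_neg (by positivity)]; congr 2; ring

theorem exists_le_of_tendsto_zero (hψ_lim : Tendsto ψ atTop (𝓝 0)) :
    ∃ C : ℝ, 0 < C ∧ ∀ k, 1 + ψ k ≤ C := by
  obtain ⟨C, hC⟩ := (hψ_lim.const_add 1).bddAbove_range
  exact ⟨max C 1, by positivity, fun k => (hC ⟨k, rfl⟩).trans (le_max_left _ _)⟩

/-- The reciprocals of `1 + ψ k` converge, so they are bounded above; inverting a positive bound
gives `c`. -/
theorem exists_ge_of_tendsto_zero (hψ_gt : ∀ k : ℕ, 1 ≤ k → -1 < ψ k)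
    (hψ_lim : Tendsto ψ atTop (𝓝 0)) :
    ∃ c : ℝ, 0 < c ∧ ∀ k, 1 ≤ k → c ≤ 1 + ψ k := by
  obtain ⟨C, hC⟩ := ((hψ_lim.const_add 1).inv₀ (by norm_num)).bddAbove_range
  refine ⟨(max C 1)⁻¹, by positivity, fun k hk => ?_⟩
  have h0 : 0 < 1 + ψ k := by linarith [hψ_gt k hk]
  rw [inv_le_comm₀ (by positivity) h0]
  exact (hC ⟨k, rfl⟩).trans (le_max_left _ _)

theorem totalWeight_pos (hψ_gt : ∀ k : ℕ, 1 ≤ k → -1 < ψ k) (hψ_lim : Tendsto ψ atTop (𝓝 0)) :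
    0 < totalWeight ψ := by
  obtain ⟨C, hC, hle⟩ := exists_le_of_tendsto_zero hψ_lim
  have hpos : ∀ l : ℕ, 0 < weight ψ (l + 1) := fun l => by
    rw [weight_eq]
    have := hψ_gt (l + 1) (by omega)
    exact mul_pos (by linarith) (by positivity)
  have hs : Summable fun l : ℕ => C * (((l + 1 : ℕ) : ℝ)) ^ (-(5 : ℝ) / 2) :=
    ((summable_nat_add_iff 1).2 (Real.summable_nat_rpow.2 (by norm_num))).mul_left C
  refine Summable.tsum_pos (hs.of_nonneg_of_le (fun l => (hpos l).le) fun l => ?_)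
    (fun l => (hpos l).le) 0 (hpos 0)
  rw [weight_eq]
  exact mul_le_mul_of_nonneg_right (hle _) (by positivity)

theorem exists_prob_le (hψ_gt : ∀ k : ℕ, 1 ≤ k → -1 < ψ k) (hψ_lim : Tendsto ψ atTop (𝓝 0)) :
    ∃ C : ℝ, 0 < C ∧ ∀ k : ℕ, prob ψ k ≤ C * (k : ℝ) ^ (-(5 : ℝ) / 2) := by
  obtain ⟨C, hC, hle⟩ := exists_le_of_tendsto_zero hψ_lim
  have hw := totalWeight_pos hψ_gt hψ_lim
  refine ⟨C / totalWeight ψ, by positivity, fun k => ?_⟩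
  rw [prob, weight_eq, div_mul_eq_mul_div]
  gcongr
  exact hle k

theorem exists_le_prob (hψ_gt : ∀ k : ℕ, 1 ≤ k → -1 < ψ k) (hψ_lim : Tendsto ψ atTop (𝓝 0)) :
    ∃ c : ℝ, 0 < c ∧ ∀ k : ℕ, 1 ≤ k → c * (k : ℝ) ^ (-(5 : ℝ) / 2) ≤ prob ψ k := by
  obtain ⟨c, hc, hle⟩ := exists_ge_of_tendsto_zero hψ_gt hψ_lim
  have hw := totalWeight_pos hψ_gt hψ_lim
  refine ⟨c / totalWeight ψ, by positivity, fun k hk => ?_⟩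
  rw [prob, weight_eq, div_mul_eq_mul_div]
  gcongr
  exact hle k hk


/-! ### Mean and tail of the variables. -/

variable {Ω : Type*} [MeasurableSpace Ω] {P : Measure Ω} {ξ : ℕ → Ω → ℕ}

theorem lintegral_eq_tsum_prob (hξ_meas : ∀ i, Measurable (ξ i))
    (hξ_law : ∀ i k : ℕ, 1 ≤ k → P {ω | ξ i ω = k} = ENNReal.ofReal (prob ψ k)) (i : ℕ) :
    ∫⁻ ω, (ξ i ω : ENNReal) ∂P = ∑' k : ℕ, (k : ENNReal) * ENNReal.ofReal (prob ψ k) := by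
  rw [← lintegral_map (f := fun k : ℕ => (k : ENNReal)) (measurable_of_countable _) (hξ_meas i),
    lintegral_countable']
  refine tsum_congr fun k => ?_
  rcases Nat.eq_zero_or_pos k with rfl | hk
  · simp
  · rw [Measure.map_apply (hξ_meas i) .of_discrete, ← hξ_law i k hk]; rfl

theorem tsum_mul_prob_ne_top (hψ_gt : ∀ k : ℕ, 1 ≤ k → -1 < ψ k)
    (hψ_lim : Tendsto ψ atTop (𝓝 0)) :
    ∑' k : ℕ, (k : ENNReal) * ENNReal.ofReal (prob ψ k) ≠ ⊤ := by
  obtain ⟨C, hC, hle⟩ := exists_prob_le hψ_gt hψ_lim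
  have hs : Summable fun k : ℕ => C * (k : ℝ) ^ (-(3 : ℝ) / 2) :=
    (Real.summable_nat_rpow.2 (by norm_num)).mul_left C
  refine ne_top_of_le_ne_top hs.tsum_ofReal_ne_top (ENNReal.tsum_le_tsum fun k => ?_)
  rw [← ENNReal.ofReal_natCast, ← ENNReal.ofReal_mul (by positivity)]
  apply ENNReal.ofReal_le_ofReal
  rcases Nat.eq_zero_or_pos k with rfl | hk
  · simp
  · have hk' : (0 : ℝ) < k := by exact_mod_cast hk
    calc (k : ℝ) * prob ψ k ≤ k * (C * (k : ℝ) ^ (-(5 : ℝ) / 2)) := by gcongr; exact hle k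
      _ = C * ((k : ℝ) ^ (-(5 : ℝ) / 2) * k) := by ring
      _ = _ := by rw [← Real.rpow_add_one hk'.ne']; norm_num

/-- The mean is finite because `k * k ^ (-5/2)` is summable, so the Bochner integral is the true `ν`
and Markov's inequality can be expressed through it. -/
theorem lintegral_eq_ofReal_integral (hψ_gt : ∀ k : ℕ, 1 ≤ k → -1 < ψ k)
    (hψ_lim : Tendsto ψ atTop (𝓝 0)) (hξ_meas : ∀ i, Measurable (ξ i))
    (hξ_law : ∀ i k : ℕ, 1 ≤ k → P {ω | ξ i ω = k} = ENNReal.ofReal (prob ψ k)) (i : ℕ) :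
    ∫⁻ ω, (ξ i ω : ENNReal) ∂P = ENNReal.ofReal (∫ ω, (ξ 0 ω : ℝ) ∂P) := by
  have h0 := lintegral_eq_tsum_prob hξ_meas hξ_law 0
  have hm : Measurable fun ω => (ξ 0 ω : ℝ) := (measurable_of_countable _).comp (hξ_meas 0)
  rw [integral_eq_lintegral_of_nonneg_ae (ae_of_all _ fun ω => by positivity)
    hm.aestronglyMeasurable]
  simp only [ENNReal.ofReal_natCast]
  rw [lintegral_eq_tsum_prob hξ_meas hξ_law i, h0,
    ENNReal.ofReal_toReal (tsum_mul_prob_ne_top hψ_gt hψ_lim)]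

theorem exists_tail_le (hψ_gt : ∀ k : ℕ, 1 ≤ k → -1 < ψ k) (hψ_lim : Tendsto ψ atTop (𝓝 0))
    (hξ_law : ∀ i k : ℕ, 1 ≤ k → P {ω | ξ i ω = k} = ENNReal.ofReal (prob ψ k)) :
    ∃ C : ℝ, 0 < C ∧ ∀ i, ∀ b : ℝ, 0 < b →
      P {ω | b < ξ i ω} ≤ ENNReal.ofReal (C * b ^ (-(3 : ℝ) / 2)) := by
  obtain ⟨C, hC, hle⟩ := exists_prob_le hψ_gt hψ_lim
  refine ⟨2 * C, by positivity, fun i b hb => ?_⟩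
  -- `K` is the least integer above `b`; the telescoping sum is at most its first term, and `K ^
  -- (-3/2) ≤ b ^ (-3/2)`.
  set K := ⌊b⌋₊ + 1 with hK
  have hsub : {ω | b < ξ i ω} ⊆ ⋃ j : ℕ, {ω | ξ i ω = K + j} := fun ω hω => by
    have : K ≤ ξ i ω := (Nat.floor_lt hb.le).2 hω
    simp only [Set.mem_iUnion, Set.mem_ofPred_eq]
    exact ⟨ξ i ω - K, by omega⟩
  set F : ℕ → ℝ := fun j => ((K + j : ℕ) : ℝ) ^ (-(3 : ℝ) / 2) with hF
  have hterm : ∀ j : ℕ, P {ω | ξ i ω = K + j} ≤ ENNReal.ofReal (2 * C * (F j - F (j + 1))) := by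
    intro j
    rw [hξ_law i (K + j) (by omega)]
    apply ENNReal.ofReal_le_ofReal
    calc _ ≤ _ := hle (K + j)
      _ ≤ C * (2 * (F j - F (j + 1))) :=
        mul_le_mul_of_nonneg_left (rpow_neg_five_halves_le (by omega)) hC.le
      _ = _ := by ring
  have hdec : ∀ j : ℕ, 0 ≤ 2 * C * (F j - F (j + 1)) := fun j => by
    have : (0 : ℝ) ≤ ((K + j : ℕ) : ℝ) ^ (-(5 : ℝ) / 2) := by positivity
    have h2 : (0 : ℝ) ≤ 2 * (F j - F (j + 1)) :=
      this.trans (rpow_neg_five_halves_le (k := K + j) (by omega))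
    nlinarith
  calc P {ω | b < ξ i ω} ≤ P (⋃ j : ℕ, {ω | ξ i ω = K + j}) := measure_mono hsub
    _ ≤ ∑' j : ℕ, P {ω | ξ i ω = K + j} := measure_iUnion_le _
    _ ≤ ∑' j : ℕ, ENNReal.ofReal (2 * C * (F j - F (j + 1))) := ENNReal.tsum_le_tsum hterm
    _ ≤ ENNReal.ofReal (2 * C * b ^ (-(3 : ℝ) / 2)) := ENNReal.tsum_le_of_sum_range_le fun n => by
      rw [← ENNReal.ofReal_sum_of_nonneg fun j _ => hdec j]
      apply ENNReal.ofReal_le_ofReal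
      rw [← Finset.mul_sum, Finset.sum_range_sub']
      have h1 : 0 ≤ F n := by positivity
      have h2 : F 0 ≤ b ^ (-(3 : ℝ) / 2) := by
        apply Real.rpow_le_rpow_of_nonpos hb _ (by norm_num)
        simpa [hK] using (Nat.lt_floor_add_one b).le
      gcongr
      linarith

/-! ### Lower bound for the probability of the conditioning event. -/

variable [IsProbabilityMeasure P]

/-- With positive probability a family of variables indexed by `s` has a small sum and no large
member, provided the mean of the sum is bounded away from `m`. -/
theorem exists_le_measure_small_rest (hψ_gt : ∀ k : ℕ, 1 ≤ k → -1 < ψ k)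
    (hψ_lim : Tendsto ψ atTop (𝓝 0)) (hξ_meas : ∀ i, Measurable (ξ i))
    (hξ_law : ∀ i k : ℕ, 1 ≤ k → P {ω | ξ i ω = k} = ENNReal.ofReal (prob ψ k))
    {q : ℝ} (hq0 : 0 ≤ q) (hq1 : q < 1) :
    ∃ δ : ℝ, 0 < δ ∧ δ < 1 ∧ ∃ c : ℝ, 0 < c ∧ ∀ᶠ m : ℕ in atTop, ∀ s : Finset ℕ, s.card ≤ m →
      (∫ ω, (ξ 0 ω : ℝ) ∂P) * s.card ≤ q * m →
      ENNReal.ofReal c ≤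
        P {ω | ((∑ l ∈ s, ξ l ω : ℕ) : ℝ) < (1 - δ) * m ∧ ∀ l ∈ s, (ξ l ω : ℝ) ≤ δ * m} := by
  obtain ⟨C, hC, htail⟩ := exists_tail_le hψ_gt hψ_lim hξ_law
  -- This `δ` gives `q < 1 - δ`, so Markov bounds the probability of a large sum by `q / (1 - δ) <
  -- 1`. Half of the gap to 1 absorbs the union bound for a large member, which is `O(m ^ (-1/2))`;
  -- the other half is the final `c`.
  set δ := (1 - q) / 2 with hδ
  have hδ0 : 0 < δ := by linarith
  have hδ1 : δ < 1 := by linarith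
  have hq' : q / (1 - δ) < 1 := by rw [div_lt_one (by linarith)]; linarith
  set c := (1 - q / (1 - δ)) / 2 with hc
  have hc0 : 0 < c := by linarith
  refine ⟨δ, hδ0, hδ1, c, hc0, ?_⟩
  have hlim : Tendsto (fun m : ℕ => C * δ ^ (-(3 : ℝ) / 2) * (m : ℝ) ^ (-(1 / 2 : ℝ))) atTop
      (𝓝 0) := by
    have := ((tendsto_rpow_neg_atTop (y := 1 / 2) (by norm_num)).comp
      tendsto_natCast_atTop_atTop).const_mul (C * δ ^ (-(3 : ℝ) / 2))
    simpa using this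
  filter_upwards [hlim.eventually_lt_const hc0, eventually_ge_atTop 1] with m hm hm1 s hs hmean
  have hm0 : (0 : ℝ) < m := by exact_mod_cast hm1
  set ν := ∫ ω, (ξ 0 ω : ℝ) ∂P with hν
  set G := {ω | ((∑ l ∈ s, ξ l ω : ℕ) : ℝ) < (1 - δ) * m ∧ ∀ l ∈ s, (ξ l ω : ℝ) ≤ δ * m} with hG
  set F₁ := {ω | ENNReal.ofReal ((1 - δ) * m) ≤ ∑ l ∈ s, (ξ l ω : ENNReal)} with hF₁
  have hcast : ∀ l, Measurable fun ω => (ξ l ω : ENNReal) := fun l =>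
    (measurable_of_countable _).comp (hξ_meas l)
  have h1 : P F₁ ≤ ENNReal.ofReal (q / (1 - δ)) := by
    have hpos : 0 < (1 - δ) * m := mul_pos (by linarith) hm0
    have hmk := mul_meas_ge_le_lintegral (μ := P) (f := fun ω => ∑ l ∈ s, (ξ l ω : ENNReal))
      (Finset.measurable_fun_sum _ fun l _ => hcast l) (ENNReal.ofReal ((1 - δ) * m))
    rw [lintegral_finsetSum _ fun l _ => hcast l] at hmk
    simp only [lintegral_eq_ofReal_integral hψ_gt hψ_lim hξ_meas hξ_law] at hmk
    rw [Finset.sum_const, nsmul_eq_mul, ← ENNReal.ofReal_natCast,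
      ← ENNReal.ofReal_mul (by positivity)] at hmk
    have h2 : ENNReal.ofReal ((1 - δ) * m) * P F₁ ≤ ENNReal.ofReal (q * m) :=
      hmk.trans (ENNReal.ofReal_le_ofReal (by rw [mul_comm]; exact hmean))
    rw [mul_comm, ← ENNReal.le_div_iff_mul_le (by simp [hpos]) (by simp),
      ← ENNReal.ofReal_div_of_pos hpos, mul_div_mul_right _ _ hm0.ne'] at h2
    exact h2
  have h2 : P (⋃ l ∈ s, {ω | δ * m < ξ l ω}) ≤ ENNReal.ofReal c := by
    calc _ ≤ ∑ l ∈ s, P {ω | δ * m < ξ l ω} := measure_biUnion_finset_le _ _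
      _ ≤ ∑ l ∈ s, ENNReal.ofReal (C * (δ * m) ^ (-(3 : ℝ) / 2)) :=
        Finset.sum_le_sum fun l _ => htail l _ (by positivity)
      _ = ENNReal.ofReal (s.card * (C * (δ * m) ^ (-(3 : ℝ) / 2))) := by
        rw [Finset.sum_const, nsmul_eq_mul, ← ENNReal.ofReal_natCast,
          ← ENNReal.ofReal_mul (by positivity)]
      _ ≤ ENNReal.ofReal c := ENNReal.ofReal_le_ofReal (by
        refine le_trans ?_ hm.le
        rw [Real.mul_rpow hδ0.le hm0.le]
        have : (m : ℝ) ^ (-(1 / 2 : ℝ)) = m * (m : ℝ) ^ (-(3 : ℝ) / 2) := by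
          rw [mul_comm, ← Real.rpow_add_one hm0.ne']; norm_num
        rw [this]
        have hs' : (s.card : ℝ) ≤ m := by exact_mod_cast hs
        calc (s.card : ℝ) * (C * (δ ^ (-(3 : ℝ) / 2) * (m : ℝ) ^ (-(3 : ℝ) / 2)))
            ≤ m * (C * (δ ^ (-(3 : ℝ) / 2) * (m : ℝ) ^ (-(3 : ℝ) / 2))) := by gcongr
          _ = _ := by ring)
  have hcov : (Set.univ : Set Ω) ⊆ G ∪ (F₁ ∪ ⋃ l ∈ s, {ω | δ * m < ξ l ω}) := by
    intro ω _
    by_cases hω1 : ((∑ l ∈ s, ξ l ω : ℕ) : ℝ) < (1 - δ) * m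
    · by_cases hω2 : ∀ l ∈ s, (ξ l ω : ℝ) ≤ δ * m
      · exact Or.inl ⟨hω1, hω2⟩
      · push Not at hω2
        right; right
        simpa using hω2
    · right; left
      rw [hF₁, Set.mem_ofPred_eq, ← Nat.cast_sum, ← ENNReal.ofReal_natCast]
      exact ENNReal.ofReal_le_ofReal (not_lt.1 hω1)
  have hone : (1 : ENNReal) ≤ P G + ENNReal.ofReal (q / (1 - δ) + c) := by
    rw [ENNReal.ofReal_add (div_nonneg hq0 (by linarith)) hc0.le, ← measure_univ (μ := P)]
    calc _ ≤ _ := measure_mono hcov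
      _ ≤ P G + P (F₁ ∪ ⋃ l ∈ s, {ω | δ * m < ξ l ω}) := measure_union_le _ _
      _ ≤ P G + (P F₁ + P (⋃ l ∈ s, {ω | δ * m < ξ l ω})) := by
        gcongr; exact measure_union_le _ _
      _ ≤ _ := by gcongr
  have : ENNReal.ofReal c = 1 - ENNReal.ofReal (q / (1 - δ) + c) := by
    rw [← ENNReal.ofReal_one, ← ENNReal.ofReal_sub _
      (add_nonneg (div_nonneg hq0 (by linarith)) hc0.le)]
    congr 1; rw [hc]; ring
  rw [this]
  exact tsub_le_iff_right.2 hone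

theorem exists_le_measure_sum_eq (hψ_gt : ∀ k : ℕ, 1 ≤ k → -1 < ψ k)
    (hψ_lim : Tendsto ψ atTop (𝓝 0)) (hξ_meas : ∀ i, Measurable (ξ i)) (hξ_indep : iIndepFun ξ P)
    (hξ_law : ∀ i k : ℕ, 1 ≤ k → P {ω | ξ i ω = k} = ENNReal.ofReal (prob ψ k))
    {q : ℝ} (hq0 : 0 ≤ q) (hq1 : q < 1) :
    ∃ c : ℝ, 0 < c ∧ ∀ᶠ m : ℕ in atTop, ∀ N : ℕ, N ≤ m →
      (∫ ω, (ξ 0 ω : ℝ) ∂P) * N ≤ q * m →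
      ENNReal.ofReal (c * N * (m : ℝ) ^ (-(5 : ℝ) / 2)) ≤
        P {ω | ∑ i ∈ Finset.range N, ξ i ω = m} := by
  obtain ⟨c₁, hc₁, hp⟩ := exists_le_prob hψ_gt hψ_lim
  obtain ⟨δ, hδ0, hδ1, c₂, hc₂, hG⟩ :=
    exists_le_measure_small_rest hψ_gt hψ_lim hξ_meas hξ_law hq0 hq1
  refine ⟨c₁ * c₂, by positivity, ?_⟩
  filter_upwards [hG, eventually_ge_atTop 1] with m hG hm1 N hN hmean
  have hm0 : (0 : ℝ) < m := by exact_mod_cast hm1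
  have hν0 : 0 ≤ ∫ ω, (ξ 0 ω : ℝ) ∂P := integral_nonneg fun ω => by positivity
  -- The event that `ξ i` is the one big jump completing the sum to `m`. The truncated subtraction
  -- is exact because the other variables sum to less than `m`.
  set A : ℕ → Set Ω := fun i =>
    {ω | (((∑ l ∈ (Finset.range N).erase i, ξ l ω : ℕ) : ℝ) < (1 - δ) * m ∧
      ∀ l ∈ (Finset.range N).erase i, (ξ l ω : ℝ) ≤ δ * m) ∧
      ξ i ω = m - ∑ l ∈ (Finset.range N).erase i, ξ l ω} with hA
  have hmeas : ∀ i, MeasurableSet (A i) := fun i => by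
    have hsum : Measurable fun ω => ∑ l ∈ (Finset.range N).erase i, ξ l ω :=
      Finset.measurable_fun_sum _ fun l _ => hξ_meas l
    have hr : ∀ f : Ω → ℕ, Measurable f → Measurable fun ω => (f ω : ℝ) := fun f hf =>
      (measurable_of_countable _).comp hf
    have hall : {ω | ∀ l ∈ (Finset.range N).erase i, (ξ l ω : ℝ) ≤ δ * m} =
        ⋂ l ∈ (Finset.range N).erase i, {ω | (ξ l ω : ℝ) ≤ δ * m} := by ext; simp
    have hall_meas : MeasurableSet {ω | ∀ l ∈ (Finset.range N).erase i, (ξ l ω : ℝ) ≤ δ * m} :=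
      hall ▸ Finset.measurableSet_biInter _ fun l _ =>
        measurableSet_le (hr _ (hξ_meas l)) measurable_const
    exact ((measurableSet_lt (hr _ hsum) measurable_const).inter hall_meas).inter
      (measurableSet_eq_fun (hξ_meas i) (measurable_const.sub hsum))
  have hlow : ∀ i ∈ Finset.range N,
      ENNReal.ofReal (c₁ * (m : ℝ) ^ (-(5 : ℝ) / 2)) * ENNReal.ofReal c₂ ≤ P (A i) := by
    intro i hi
    have hcard : ((Finset.range N).erase i).card ≤ N := by
      simpa using Finset.card_le_card (Finset.erase_subset i (Finset.range N))
    have hPG := hG ((Finset.range N).erase i) (hcard.trans hN)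
      ((mul_le_mul_of_nonneg_left (by exact_mod_cast hcard) hν0).trans hmean)
    have hind := indepFun_restrict hξ_meas hξ_indep (Finset.notMem_erase i (Finset.range N))
    have hcoe : ∀ ω, ∑ l : (Finset.range N).erase i, ξ l ω =
        ∑ l ∈ (Finset.range N).erase i, ξ l ω := fun ω =>
      Finset.sum_coe_sort ((Finset.range N).erase i) fun l => ξ l ω
    have hT : Measurable fun ω (l : (Finset.range N).erase i) => ξ l ω :=
      measurable_pi_lambda _ fun l => hξ_meas l
    have := le_measure_joint hT (hξ_meas i) hind
      {t | ((∑ l, t l : ℕ) : ℝ) < (1 - δ) * m ∧ ∀ l, (t l : ℝ) ≤ δ * m}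
      (fun t => {m - ∑ l, t l})
      (M := ENNReal.ofReal (c₁ * (m : ℝ) ^ (-(5 : ℝ) / 2))) fun t ht => by
        have hlt : ∑ l, t l < m := by
          have : ((∑ l, t l : ℕ) : ℝ) < m := ht.1.trans_le (by nlinarith)
          exact_mod_cast this
        simp only [Set.mem_singleton_iff]
        rw [hξ_law i _ (by omega)]
        apply ENNReal.ofReal_le_ofReal
        refine le_trans ?_ (hp (m - ∑ l, t l) (by omega))
        gcongr c₁ * ?_
        apply Real.rpow_le_rpow_of_nonpos (by exact_mod_cast (by omega : 0 < m - ∑ l, t l)) _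
          (by norm_num)
        exact_mod_cast Nat.sub_le _ _
    simp only [Set.mem_ofPred_eq, Set.mem_singleton_iff, Subtype.forall, hcoe] at this
    exact (mul_le_mul_right hPG _).trans this
  -- On `A i` the jump satisfies `ξ i > δ * m`, whereas `A j` requires `ξ i ≤ δ * m`.
  have hdisj : (↑(Finset.range N) : Set ℕ).PairwiseDisjoint A := by
    intro i hi j hj hij
    refine Set.disjoint_left.2 fun ω hωi hωj => ?_
    have h1 := hωi.1.1
    have h2 := hωj.1.2 i (Finset.mem_erase.2 ⟨hij, hi⟩)
    have h3 := hωi.2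
    have hlt : ∑ l ∈ (Finset.range N).erase i, ξ l ω < m := by
      have : ((∑ l ∈ (Finset.range N).erase i, ξ l ω : ℕ) : ℝ) < m := h1.trans_le (by nlinarith)
      exact_mod_cast this
    have h4 : ((ξ i ω : ℕ) : ℝ) = m - ((∑ l ∈ (Finset.range N).erase i, ξ l ω : ℕ) : ℝ) := by
      rw [h3, Nat.cast_sub hlt.le]
    linarith
  have hsub : (⋃ i ∈ Finset.range N, A i) ⊆ {ω | ∑ i ∈ Finset.range N, ξ i ω = m} := by
    intro ω hω
    simp only [Set.mem_iUnion] at hω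
    obtain ⟨i, hi, hωi⟩ := hω
    have hlt : ∑ l ∈ (Finset.range N).erase i, ξ l ω < m := by
      have : ((∑ l ∈ (Finset.range N).erase i, ξ l ω : ℕ) : ℝ) < m :=
        hωi.1.1.trans_le (by nlinarith)
      exact_mod_cast this
    have h3 := hωi.2
    rw [Set.mem_ofPred_eq, ← Finset.add_sum_erase _ _ hi]
    omega
  calc ENNReal.ofReal (c₁ * c₂ * N * (m : ℝ) ^ (-(5 : ℝ) / 2))
      = ∑ i ∈ Finset.range N,
          ENNReal.ofReal (c₁ * (m : ℝ) ^ (-(5 : ℝ) / 2)) * ENNReal.ofReal c₂ := by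
        rw [Finset.sum_const, Finset.card_range, nsmul_eq_mul, ← ENNReal.ofReal_mul (by positivity),
          ← ENNReal.ofReal_natCast, ← ENNReal.ofReal_mul (by positivity)]
        congr 1; ring
    _ ≤ ∑ i ∈ Finset.range N, P (A i) := Finset.sum_le_sum hlow
    _ = P (⋃ i ∈ Finset.range N, A i) :=
        (measure_biUnion_finset hdisj fun i _ => hmeas i).symm
    _ ≤ _ := measure_mono hsub

/-! ### Upper bound for two large values. -/

theorem exists_measure_two_large_le (hψ_gt : ∀ k : ℕ, 1 ≤ k → -1 < ψ k)
    (hψ_lim : Tendsto ψ atTop (𝓝 0)) (hξ_meas : ∀ i, Measurable (ξ i)) (hξ_indep : iIndepFun ξ P)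
    (hξ_law : ∀ i k : ℕ, 1 ≤ k → P {ω | ξ i ω = k} = ENNReal.ofReal (prob ψ k)) :
    ∃ C : ℝ, 0 < C ∧ ∀ (m N : ℕ) (a b : ℝ), 0 < a → 0 < b →
      P {ω | ∑ i ∈ Finset.range N, ξ i ω = m ∧ a < kthLargest (fun i => ξ i ω) N 1 ∧
          b < kthLargest (fun i => ξ i ω) N 2} ≤
        ENNReal.ofReal (C * N ^ 2 * a ^ (-(5 : ℝ) / 2) * b ^ (-(3 : ℝ) / 2)) := by
  obtain ⟨C₁, hC₁, hp⟩ := exists_prob_le hψ_gt hψ_lim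
  obtain ⟨C₂, hC₂, htail⟩ := exists_tail_le hψ_gt hψ_lim hξ_law
  refine ⟨C₁ * C₂, by positivity, fun m N a b ha hb => ?_⟩
  set D := ENNReal.ofReal (C₁ * a ^ (-(5 : ℝ) / 2) * (C₂ * b ^ (-(3 : ℝ) / 2))) with hD
  set E : ℕ → ℕ → Set Ω := fun i j =>
    {ω | b < ξ j ω ∧ a < ξ i ω ∧ ξ i ω + ∑ l ∈ (Finset.range N).erase i, ξ l ω = m} with hE
  have hsub : {ω | ∑ i ∈ Finset.range N, ξ i ω = m ∧ a < kthLargest (fun i => ξ i ω) N 1 ∧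
      b < kthLargest (fun i => ξ i ω) N 2} ⊆
      ⋃ i ∈ Finset.range N, ⋃ j ∈ (Finset.range N).erase i, E i j := by
    rintro ω ⟨hsum, h1, h2⟩
    obtain ⟨i, hi, j, hj, hai, hbj⟩ := exists_ne_of_lt_kthLargest hb.le h1 h2
    simp only [Set.mem_iUnion]
    refine ⟨i, hi, j, hj, hbj, hai, ?_⟩
    rw [Finset.add_sum_erase _ (fun l => ξ l ω) hi, hsum]
  have hpair : ∀ i, ∀ j ∈ (Finset.range N).erase i, P (E i j) ≤ D := by
    intro i j hj
    have hind := indepFun_restrict hξ_meas hξ_indep (Finset.notMem_erase i (Finset.range N))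
    have hcoe : ∀ ω, ∑ l : (Finset.range N).erase i, ξ l ω =
        ∑ l ∈ (Finset.range N).erase i, ξ l ω := fun ω =>
      Finset.sum_coe_sort ((Finset.range N).erase i) fun l => ξ l ω
    have hT : Measurable fun ω (l : (Finset.range N).erase i) => ξ l ω :=
      measurable_pi_lambda _ fun l => hξ_meas l
    have := measure_joint_le hT (hξ_meas i) hind {t | b < t ⟨j, hj⟩}
      (fun t => {k | a < k ∧ k + ∑ l, t l = m})
      (M := ENNReal.ofReal (C₁ * a ^ (-(5 : ℝ) / 2))) fun t _ => by
        -- Given the others, `ξ i` has at most one admissible value. If this difference is not above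
        -- `a`, which includes truncation to `0`, there is none.
        by_cases hk : a < (m - ∑ l, t l : ℕ)
        · have hk1 : 1 ≤ m - ∑ l, t l := by
            have : (0 : ℝ) < (m - ∑ l, t l : ℕ) := ha.trans hk
            exact_mod_cast this
          calc _ ≤ P {ω | ξ i ω = m - ∑ l, t l} := measure_mono fun ω hω => by
                have := hω.2
                simp only [Set.mem_ofPred_eq]
                omega
            _ = _ := hξ_law i _ hk1
            _ ≤ _ := ENNReal.ofReal_le_ofReal ((hp _).trans (mul_le_mul_of_nonneg_left
                (Real.rpow_le_rpow_of_nonpos ha hk.le (by norm_num)) hC₁.le))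
        · have : {ω | ξ i ω ∈ {k : ℕ | a < k ∧ k + ∑ l, t l = m}} = ∅ := by
            refine Set.eq_empty_of_forall_notMem fun ω hω => hk ?_
            have h2 := hω.2
            rw [← h2, Nat.add_sub_cancel]
            exact hω.1
          rw [this]; simp
    simp only [Set.mem_ofPred_eq, hcoe] at this
    rw [hD, ENNReal.ofReal_mul (by positivity)]
    exact this.trans (mul_le_mul_right (htail j b hb) _)
  calc _ ≤ P (⋃ i ∈ Finset.range N, ⋃ j ∈ (Finset.range N).erase i, E i j) := measure_mono hsub
    _ ≤ ∑ i ∈ Finset.range N, P (⋃ j ∈ (Finset.range N).erase i, E i j) :=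
      measure_biUnion_finset_le _ _
    _ ≤ ∑ i ∈ Finset.range N, ∑ j ∈ (Finset.range N).erase i, P (E i j) :=
      Finset.sum_le_sum fun i _ => measure_biUnion_finset_le _ _
    _ ≤ ∑ i ∈ Finset.range N, ∑ j ∈ (Finset.range N).erase i, D :=
      Finset.sum_le_sum fun i _ => Finset.sum_le_sum fun j hj => hpair i j hj
    _ ≤ ∑ i ∈ Finset.range N, ∑ j ∈ Finset.range N, D :=
      Finset.sum_le_sum fun i _ => Finset.sum_le_sum_of_subset (Finset.erase_subset _ _)
    _ = _ := by
      simp only [Finset.sum_const, Finset.card_range, nsmul_eq_mul, hD]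
      rw [← ENNReal.ofReal_natCast, ← ENNReal.ofReal_mul (by positivity),
        ← ENNReal.ofReal_mul (by positivity)]
      congr 1; ring

end RandomAllocation

/-! ### The quotient of the two bounds. -/

theorem proposition3p2
    -- the law of `ξ`
    (ψ : ℕ → ℝ) (hψ_gt : ∀ k : ℕ, 1 ≤ k → -1 < ψ k) (hψ_lim : Tendsto ψ atTop (𝓝 0))
    -- independent copies of `ξ` (the `N` first ones are `ξ 0, …, ξ (N - 1)`)
    {Ω : Type*} [MeasurableSpace Ω] (P : Measure Ω) [IsProbabilityMeasure P]
    (ξ : ℕ → Ω → ℕ) (hξ_meas : ∀ i, Measurable (ξ i)) (hξ_indep : iIndepFun ξ P)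
    (hξ_law : ∀ i k : ℕ, 1 ≤ k → P {ω | ξ i ω = k} = ENNReal.ofReal (RandomAllocation.prob ψ k))
    -- the sequences `r` and `N`; `m n` is `n - r n`
    (r N : ℕ → ℕ)
    (hr_gt : ∀ᶠ n : ℕ in atTop, Real.log n ^ 25 < (r n : ℝ))
    (hr_o : (fun n : ℕ => (r n : ℝ)) =o[atTop] (fun n : ℕ => (n : ℝ)))
    (hN : ∀ᶠ n : ℕ in atTop, 1 ≤ N n ∧ N n ≤ n - r n)
    (hlimsup : limsup (fun n : ℕ =>
        (((∫ ω, (ξ 0 ω : ℝ) ∂P) * (N n : ℝ) / ((n - r n : ℕ) : ℝ) : ℝ) : EReal)) atTop < 1) :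
    (∀ᶠ n : ℕ in atTop, 0 < P {ω | ∑ i ∈ Finset.range (N n), ξ i ω = n - r n}) ∧
    (fun n : ℕ =>
      (P[|{ω | ∑ i ∈ Finset.range (N n), ξ i ω = n - r n}]).real
        {ω | ((n - r n : ℕ) : ℝ) / Real.log n ^ 2
                < (RandomAllocation.kthLargest (fun i => ξ i ω) (N n) 1 : ℝ) ∧
             (r n : ℝ) ^ ((5 : ℝ) / 6)
                < (RandomAllocation.kthLargest (fun i => ξ i ω) (N n) 2 : ℝ)})
      =O[atTop] (fun n : ℕ => (N n : ℝ) * Real.log n ^ 5 * (r n : ℝ) ^ (-(5 : ℝ) / 4)) := by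
  have hν0 : 0 ≤ ∫ ω, (ξ 0 ω : ℝ) ∂P := integral_nonneg fun ω => by positivity
  obtain ⟨q', hq'lim, hq'1⟩ := EReal.lt_iff_exists_real_btwn.1 hlimsup
  have hq'1 : q' < 1 := by exact_mod_cast hq'1
  -- A real level strictly between the limsup and 1, made nonnegative as the lower bound requires.
  set q := max q' 0 with hq
  have hq1 : q < 1 := max_lt hq'1 one_pos
  obtain ⟨c, hc, hlow⟩ := RandomAllocation.exists_le_measure_sum_eq hψ_gt hψ_lim hξ_meas
    hξ_indep hξ_law (le_max_right q' 0) hq1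
  obtain ⟨C, hC, hup⟩ := RandomAllocation.exists_measure_two_large_le hψ_gt hψ_lim hξ_meas
    hξ_indep hξ_law
  have hm_tendsto : Tendsto (fun n : ℕ => n - r n) atTop atTop := by
    rw [← tendsto_natCast_atTop_iff (R := ℝ)]
    have hhalf : Tendsto (fun n : ℕ => (1 / 2 : ℝ) * n) atTop atTop :=
      tendsto_natCast_atTop_atTop.const_mul_atTop (by norm_num)
    refine tendsto_atTop_mono' _ ?_ hhalf
    filter_upwards [hr_o.bound (by norm_num : (0 : ℝ) < 1 / 2)] with n hn
    simp only [Real.norm_natCast] at hn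
    have : (n : ℝ) ≤ ((n - r n : ℕ) : ℝ) + r n := by exact_mod_cast le_tsub_add
    linarith
  have hden : ∀ᶠ n : ℕ in atTop, 1 ≤ N n ∧ 0 < n - r n ∧
      ENNReal.ofReal (c * N n * ((n - r n : ℕ) : ℝ) ^ (-(5 : ℝ) / 2)) ≤
        P {ω | ∑ i ∈ Finset.range (N n), ξ i ω = n - r n} := by
    filter_upwards [hm_tendsto.eventually hlow, hN, eventually_lt_of_limsup_lt hq'lim]
      with n hn hNn hlt
    have hm : 0 < n - r n := hNn.1.trans hNn.2
    refine ⟨hNn.1, hm, hn (N n) hNn.2 ?_⟩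
    have hm' : (0 : ℝ) < ((n - r n : ℕ) : ℝ) := by exact_mod_cast hm
    have hlt' := (EReal.coe_lt_coe_iff.1 hlt).trans_le (le_max_left q' 0)
    exact ((div_lt_iff₀ hm').1 hlt').le
  refine ⟨?_, ?_⟩
  · filter_upwards [hden] with n ⟨hN1, hm, hn⟩
    refine lt_of_lt_of_le (ENNReal.ofReal_pos.2 ?_) hn
    have h1 : (0 : ℝ) < N n := by exact_mod_cast hN1
    have h2 : (0 : ℝ) < ((n - r n : ℕ) : ℝ) := by exact_mod_cast hm
    positivity
  · refine IsBigO.of_bound (C / c) ?_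
    filter_upwards [hden, hr_gt, eventually_gt_atTop 1] with n ⟨hN1, hm, hn⟩ hr hn1
    have hlog : 0 < Real.log n := Real.log_pos (by exact_mod_cast hn1)
    have hr0 : (0 : ℝ) < r n := (by positivity : (0 : ℝ) < Real.log n ^ 25).trans hr
    have h1 : (0 : ℝ) < N n := by exact_mod_cast hN1
    have h2 : (0 : ℝ) < ((n - r n : ℕ) : ℝ) := by exact_mod_cast hm
    set m : ℝ := ((n - r n : ℕ) : ℝ) with hm_def
    have hnum := hup (n - r n) (N n) (m / Real.log n ^ 2) ((r n : ℝ) ^ ((5 : ℝ) / 6))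
      (by positivity) (by positivity)
    have hpow_r : ((r n : ℝ) ^ ((5 : ℝ) / 6)) ^ (-(3 : ℝ) / 2) = (r n : ℝ) ^ (-(5 : ℝ) / 4) := by
      rw [← Real.rpow_mul hr0.le]; norm_num
    -- Source of the factor `log n ^ 5`: the threshold `m / log n ^ 2` is raised to the power
    -- `-5/2`.
    have hpow_log : (Real.log n ^ 2) ^ (-(5 : ℝ) / 2) = (Real.log n ^ 5)⁻¹ := by
      rw [← Real.rpow_natCast, ← Real.rpow_mul hlog.le, ← Real.rpow_natCast,
        ← Real.rpow_neg hlog.le]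
      norm_num
    rw [hpow_r, Real.div_rpow h2.le (by positivity), hpow_log, div_inv_eq_mul] at hnum
    have hE : MeasurableSet {ω | ∑ i ∈ Finset.range (N n), ξ i ω = n - r n} :=
      measurableSet_eq_fun (Finset.measurable_fun_sum _ fun l _ => hξ_meas l) measurable_const
    rw [Real.norm_of_nonneg (by positivity), Real.norm_of_nonneg (by positivity), measureReal_def,
      cond_apply hE, ENNReal.toReal_mul, ENNReal.toReal_inv, ← measureReal_def]
    have hden' : c * N n * m ^ (-(5 : ℝ) / 2) ≤
        P.real {ω | ∑ i ∈ Finset.range (N n), ξ i ω = n - r n} :=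
      (ENNReal.ofReal_le_iff_le_toReal (measure_ne_top _ _)).1 hn
    have hnum' := ENNReal.toReal_le_of_le_ofReal (by positivity) hnum
    have hd0 : 0 < c * N n * m ^ (-(5 : ℝ) / 2) := by positivity
    calc _ ≤ (c * N n * m ^ (-(5 : ℝ) / 2))⁻¹ *
          (C * N n ^ 2 * (m ^ (-(5 : ℝ) / 2) * Real.log n ^ 5) * (r n : ℝ) ^ (-(5 : ℝ) / 4)) := by
          gcongr
          exact hnum'
      _ = _ := by
          have : m ^ (-(5 : ℝ) / 2) ≠ 0 := by positivity
          field_simp
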